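/- Let $\iota$ be a countable index set with $d$ elements, $d$ finite or countably infinite, and let $\mathbb B^d$ be the set of families $z=(z_i)_{i\in\iota}$ of complex numbers with $\sum_i|z_i|^2<1$. Let $H^2_d$ be the Drury--Arveson space, that is, the Hilbert space of functions on $\mathbb B^d$ with reproducing kernel $$k(z,w)=\frac1{1-\sum_{i}z_i\overline{w_i}} .$$ A function $\varphi:\mathbb B^d\to\mathbb C$ is a multiplier of $H^2_d$, written $\varphi\in \mathrm{Mult}(H^2_d)$, if $f\mapsto\varphi f$ is a bounded operator of $H^2_d$ into itself; a multiplier $\varphi$ is outer if $\varphi H^2_d$ is dense in $H^2_d$. A column $(\varphi_k)_{k}$ of functions on $\mathbb B^d$ is a contractive multiplier if $f\mapsto(\varphi_k f)_{k}$ maps $H^2_d$ contractively into the Hilbert space direct sum $\bigoplus_{k} H^2_d$. Let $(h_i)_{i\ge1}$ be a sequence in $H^2_d$ with $\sum_{i=1}^\infty\|h_i\|^2<\infty$. Then there exist multipliers $a,b_1,b_2,\dots\in \mathrm{Mult}(H^2_d)$ such that: 1. $a$ is outer; 2. $a$ has no zeros in $\mathbb B^d$ and $h_i=b_i/a$ for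 every $i$; 3. the column $(a,b_1,b_2,\dots)^{T}$ is a contractive multiplier; 4. $1/a\in H^2_d$ and $\|1/a\|_{H^2_d}^2\le 1+\sum_{i=1}^\infty\|h_i\|_{H^2_d}^2$. -/

import Mathlib

open scoped InnerProductSpace ComplexConjugate

noncomputable section

namespace DruryArveson

/-- The open unit ball of `ℂ^d`, where `d` is the number of elements of the index set `ι`; for
infinite `ι` it is the open unit ball of `ℓ²(ι)`. Its points are the square-summable families
`z = (z i)` with `∑ |z i|² < 1`. -/
abbrev UnitBall (ι : Type*) : Type _ :=
  Metric.ball (0 : lp (fun _ : ι => ℂ) 2) 1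

/-- The Drury-Arveson kernel `k(z, w) = (1 - ∑ i, z i * conj (w i))⁻¹`. The inner product of
Mathlib is conjugate-linear in its first argument. -/
def kernel {ι : Type*} (z w : UnitBall ι) : ℂ :=
  (1 - ⟪(w : lp (fun _ : ι => ℂ) 2), (z : lp (fun _ : ι => ℂ) 2)⟫_ℂ)⁻¹

/-- Mathlib's reproducing kernels are operator-valued: the kernel as multiplication by the
number `k(z, w)` on `ℂ`. -/
def kernelMatrix (ι : Type*) : Matrix (UnitBall ι) (UnitBall ι) (ℂ →L[ℂ] ℂ) :=
  Matrix.of fun z w => kernel z w • ContinuousLinearMap.id ℂ ℂ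

theorem norm_inner_lt_one {ι : Type*} (z w : UnitBall ι) :
    ‖⟪(w : lp (fun _ : ι => ℂ) 2), (z : lp (fun _ : ι => ℂ) 2)⟫_ℂ‖ < 1 := by
  have hz : ‖(z : lp (fun _ : ι => ℂ) 2)‖ < 1 := mem_ball_zero_iff.1 z.2
  have hw : ‖(w : lp (fun _ : ι => ℂ) 2)‖ < 1 := mem_ball_zero_iff.1 w.2
  calc _ ≤ ‖(w : lp (fun _ : ι => ℂ) 2)‖ * ‖(z : lp (fun _ : ι => ℂ) 2)‖ := norm_inner_le_norm _ _
    _ < 1 := mul_lt_one_of_nonneg_of_lt_one_left (norm_nonneg _) hw hz.le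

theorem kernel_eq_tsum {ι : Type*} (z w : UnitBall ι) :
    kernel z w = (1 - ∑' i, z.1 i * conj (w.1 i))⁻¹ := by
  simp [kernel, lp.inner_eq_tsum]

theorem hasSum_kernel {ι : Type*} (z w : UnitBall ι) :
    HasSum (fun n : ℕ => ⟪(w : lp (fun _ : ι => ℂ) 2), (z : lp (fun _ : ι => ℂ) 2)⟫_ℂ ^ n)
      (kernel z w) :=
  hasSum_geometric_of_norm_lt_one (norm_inner_lt_one z w)

theorem conj_kernel {ι : Type*} (z w : UnitBall ι) : conj (kernel z w) = kernel w z := by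
  simp [kernel, inner_conj_symm]

open scoped ComplexOrder in
theorem posSemidef_gram_pow {𝕜 E X : Type*} [RCLike 𝕜] [NormedAddCommGroup E]
    [InnerProductSpace 𝕜 E] (v : X → E) (n : ℕ) :
    (Matrix.of fun x y : X => ⟪v x, v y⟫_𝕜 ^ n).PosSemidef := by
  induction n with
  | zero =>
    refine ⟨by ext; simp, fun g => ?_⟩
    have : (g.sum fun i xi => g.sum fun j xj => star xi *
        (Matrix.of fun x y : X => ⟪v x, v y⟫_𝕜 ^ 0) i j * xj)
        = star (∑ x ∈ g.support, g x) * ∑ x ∈ g.support, g x := by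
      simp [Finsupp.sum, Finset.sum_mul_sum]
    rw [this]
    exact star_mul_self_nonneg _
  | succ n ih =>
    have hgram : (Matrix.of fun x y : X => ⟪v x, v y⟫_𝕜).PosSemidef := by
      refine ⟨by ext; simp, fun g => ?_⟩
      have : (g.sum fun i xi => g.sum fun j xj => star xi *
          (Matrix.of fun x y : X => ⟪v x, v y⟫_𝕜) i j * xj)
          = ⟪∑ x ∈ g.support, g x • v x, ∑ x ∈ g.support, g x • v x⟫_𝕜 := by
        rw [sum_inner]
        refine Finset.sum_congr rfl fun x _ => ?_
        rw [inner_sum]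
        refine Finset.sum_congr rfl fun y _ => ?_
        simp only [inner_smul_left, inner_smul_right, Matrix.of_apply, RCLike.star_def]
        ring
      rw [this, inner_self_eq_norm_sq_to_K]
      exact_mod_cast sq_nonneg ‖∑ x ∈ g.support, g x • v x‖
    have h := ih.hadamard hgram
    have e : (Matrix.of fun x y : X => ⟪v x, v y⟫_𝕜 ^ (n + 1)) =
        (Matrix.of fun x y : X => ⟪v x, v y⟫_𝕜 ^ n).hadamard
          (Matrix.of fun x y : X => ⟪v x, v y⟫_𝕜) := by
      ext x y
      simp [pow_succ]
    rw [e]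
    exact h

open scoped ComplexOrder in
theorem re_sum_pow_nonneg {𝕜 E X : Type*} [RCLike 𝕜] [NormedAddCommGroup E]
    [InnerProductSpace 𝕜 E] (v : X → E) (n : ℕ) (f : X →₀ 𝕜) :
    0 ≤ RCLike.re (∑ x ∈ f.support, ∑ y ∈ f.support, conj (f x) * ⟪v y, v x⟫_𝕜 ^ n * f y) :=
  (RCLike.nonneg_iff.1 ((posSemidef_gram_pow (𝕜 := 𝕜) v n).transpose.2 f)).1

/-- The Drury-Arveson kernel is positive semidefinite. -/
instance instFactPosSemidef (ι : Type*) : Fact (kernelMatrix ι).PosSemidef := by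
  have t := (RKHS.posSemidef_tfae (K := kernelMatrix ι)).out 0 2
  refine ⟨t.2 ⟨?_, fun f => ?_⟩⟩
  · ext z w
    have h1 : star (ContinuousLinearMap.id ℂ ℂ) = ContinuousLinearMap.id ℂ ℂ := star_one _
    simp [kernelMatrix, conj_kernel, h1]
  · have h : HasSum (fun n : ℕ => ∑ x ∈ f.support, ∑ y ∈ f.support, conj (f x) *
        ⟪(y : lp (fun _ : ι => ℂ) 2), (x : lp (fun _ : ι => ℂ) 2)⟫_ℂ ^ n * f y)
        (∑ x ∈ f.support, ∑ y ∈ f.support, conj (f x) * kernel x y * f y) :=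
      hasSum_sum fun x _ => hasSum_sum fun y _ =>
        ((hasSum_kernel x y).mul_left _).mul_right _
    have h1 : 0 ≤ (∑ x ∈ f.support, ∑ y ∈ f.support, conj (f x) * kernel x y * f y).re :=
      (Complex.hasSum_re h).nonneg fun n =>
        re_sum_pow_nonneg (𝕜 := ℂ) (fun x : UnitBall ι => (x : lp (fun _ : ι => ℂ) 2)) n f
    refine h1.trans_eq (congrArg Complex.re ?_)
    simp only [Finsupp.sum, kernelMatrix, Matrix.of_apply]
    refine Finset.sum_congr rfl fun x _ => Finset.sum_congr rfl fun y _ => ?_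
    simp [conj_kernel]
    ring

/-- The Drury-Arveson space `H²_d`: the Hilbert space of functions on the unit ball with
reproducing kernel `k(z, w) = (1 - ∑ i, z i * conj (w i))⁻¹`. -/
abbrev H2 (ι : Type*) : Type _ := RKHS.OfKernel (kernelMatrix ι)

theorem kernel_H2 (ι : Type*) : RKHS.kernel (H2 ι) = kernelMatrix ι :=
  RKHS.OfKernel.kernel_ofKernel

/-- `φ` belongs to `Mult(H²_d)`: multiplication by `φ` is a bounded operator of `H²_d` into
itself. -/
def IsMultiplier {ι : Type*} (φ : UnitBall ι → ℂ) : Prop :=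
  ∃ T : H2 ι →L[ℂ] H2 ι, ∀ (f : H2 ι) (z : UnitBall ι), T f z = φ z * f z

/-- `φ` is `H²_d`-outer: it is a multiplier and `φ H²_d` is dense in `H²_d`. -/
def IsOuter {ι : Type*} (φ : UnitBall ι → ℂ) : Prop :=
  IsMultiplier φ ∧ Dense {g : H2 ι | ∃ f : H2 ι, ∀ z : UnitBall ι, g z = φ z * f z}

/-- The column with entries `φ k` is a contractive multiplier: `f ↦ (φ k * f)_k` is a linear
contraction of `H²_d` into the Hilbert space direct sum of copies of `H²_d`. -/
def IsContractiveColumn {ι κ : Type*} (φ : κ → UnitBall ι → ℂ) : Prop :=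
  ∃ T : H2 ι →L[ℂ] lp (fun _ : κ => H2 ι) 2, ‖T‖ ≤ 1 ∧
    ∀ (f : H2 ι) (k : κ) (z : UnitBall ι), T f k z = φ k z * f z

end DruryArveson

end

/-! The constraint is moved to the full Fock space, where factorization is geometry. `H2 ι` embeds
isometrically into it by `fockLift`, and pairing with `fockKernel z` turns the word `w` into the
monomial `z^w`. The column `(1, h₁, h₂, …)` lifts to a vector `F` in a direct sum of Fock spaces, on
which the creation operators act as a pure row isometry.

By `exists_wandering`, `F` lies in the closed span of an orthonormal family `L_w Ω`. Hence `F = V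
G`, where the isometry `V` sends the unit vector at `w` to `L_w Ω`, and `‖G‖ = ‖F‖`. Evaluation at
`z` is multiplicative (`fockKernel_inner_linearIsometry`), so each entry satisfies `F_k(z) = Ω_k(z)
G(z)`. With `a` and the `b_i` the entries of `Ω` and `g` the restriction of `G`, this reads `a g =
1` and `b_i g = h_i`.

The column is contractive because it is `V` composed with contractions
(`isContractiveColumn_of_orthonormal`). The bound on `1/a` is `‖g‖ ≤ ‖G‖ = ‖F‖`, and outerness
follows from `1/a ∈ H²_d` (`IsMultiplier.isOuter`). -/

namespace DruryArveson

/-! ### Wandering vectors of pure row isometries. -/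

section RowIsometry

variable {ι κ K : Type*} [NormedAddCommGroup K] [InnerProductSpace ℂ K]

/-- The operator `L i₁ * ⋯ * L iₙ` attached to the word `i₁ ⋯ iₙ`. -/
def wordOp (L : ι → K →L[ℂ] K) (w : List ι) : K →L[ℂ] K := (w.map L).prod

@[simp] theorem wordOp_nil (L : ι → K →L[ℂ] K) (x : K) : wordOp L [] x = x := by
  simp [wordOp]

@[simp] theorem wordOp_cons (L : ι → K →L[ℂ] K) (i : ι) (w : List ι) (x : K) :
    wordOp L (i :: w) x = L i (wordOp L w x) := by
  simp [wordOp]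

/-- The closed linear span of the vectors `L_w x`. -/
def cyclicSpan (L : ι → K →L[ℂ] K) (x : K) : Submodule ℂ K :=
  (Submodule.span ℂ (Set.range fun w => wordOp L w x)).topologicalClosure

/-- The closed linear span of the vectors `L_w x` with `w` not empty. -/
def properSpan (L : ι → K →L[ℂ] K) (x : K) : Submodule ℂ K :=
  (Submodule.span ℂ (Set.range fun p : ι × List ι => wordOp L (p.1 :: p.2) x)).topologicalClosure

theorem wordOp_mem_cyclicSpan (L : ι → K →L[ℂ] K) (x : K) (w : List ι) :
    wordOp L w x ∈ cyclicSpan L x :=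
  Submodule.le_topologicalClosure _ (Submodule.subset_span ⟨w, rfl⟩)

theorem wordOp_mem_properSpan (L : ι → K →L[ℂ] K) (x : K) (i : ι) (w : List ι) :
    wordOp L (i :: w) x ∈ properSpan L x :=
  Submodule.le_topologicalClosure _ (Submodule.subset_span ⟨(i, w), rfl⟩)

theorem cyclicSpan_le {L : ι → K →L[ℂ] K} {x : K} {S : Submodule ℂ K}
    (hS : IsClosed (S : Set K)) (h : ∀ w, wordOp L w x ∈ S) : cyclicSpan L x ≤ S := by
  refine Submodule.topologicalClosure_minimal _ (Submodule.span_le.2 ?_) hS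
  rintro _ ⟨w, rfl⟩
  exact h w

theorem properSpan_le {L : ι → K →L[ℂ] K} {x : K} {S : Submodule ℂ K}
    (hS : IsClosed (S : Set K)) (h : ∀ i w, wordOp L (i :: w) x ∈ S) : properSpan L x ≤ S := by
  refine Submodule.topologicalClosure_minimal _ (Submodule.span_le.2 ?_) hS
  rintro _ ⟨p, rfl⟩
  exact h p.1 p.2

theorem isClosed_cyclicSpan (L : ι → K →L[ℂ] K) (x : K) :
    IsClosed (cyclicSpan L x : Set K) := Submodule.isClosed_topologicalClosure _

theorem isClosed_properSpan (L : ι → K →L[ℂ] K) (x : K) :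
    IsClosed (properSpan L x : Set K) := Submodule.isClosed_topologicalClosure _

theorem properSpan_le_cyclicSpan (L : ι → K →L[ℂ] K) (x : K) :
    properSpan L x ≤ cyclicSpan L x :=
  properSpan_le (isClosed_cyclicSpan L x) fun _ _ => wordOp_mem_cyclicSpan L x _

theorem map_mem_properSpan {L : ι → K →L[ℂ] K} {x y : K} (hy : y ∈ cyclicSpan L x) (i : ι) :
    L i y ∈ properSpan L x := by
  have h : cyclicSpan L x ≤ (properSpan L x).comap (L i).toLinearMap :=
    cyclicSpan_le ((isClosed_properSpan L x).preimage (L i).continuous) fun w => by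
      simpa using wordOp_mem_properSpan L x i w
  exact h hy

theorem wordOp_map_mem_cyclicSpan {L : ι → K →L[ℂ] K} {x y : K} (hy : y ∈ cyclicSpan L x)
    (w : List ι) : wordOp L w y ∈ cyclicSpan L x := by
  induction w with
  | nil => simpa using hy
  | cons i w ih => simpa using properSpan_le_cyclicSpan L x (map_mem_properSpan ih i)

-- Common first letters cancel by `hL` and distinct ones give orthogonal ranges, so every pairing
-- reduces to one with an empty word.
open scoped Classical in
theorem orthonormal_wordOp {L : ι → K →L[ℂ] K}
    (hL : ∀ i j x y, ⟪L i x, L j y⟫_ℂ = if i = j then ⟪x, y⟫_ℂ else 0) {x : K} (hx : ‖x‖ = 1)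
    (h : ∀ i w, ⟪x, wordOp L (i :: w) x⟫_ℂ = 0) : Orthonormal ℂ fun w => wordOp L w x := by
  rw [orthonormal_iff_ite]
  intro w
  induction w with
  | nil =>
    intro v
    cases v with
    | nil => simp [inner_self_eq_norm_sq_to_K, hx]
    | cons j v => simpa using h j v
  | cons i w ih =>
    intro v
    cases v with
    | nil =>
      simp only [wordOp_nil, reduceCtorEq, if_false]
      rw [← inner_conj_symm, h i w, map_zero]
    | cons j v =>
      simp only [wordOp_cons, hL, ih, List.cons.injEq]
      split_ifs <;> simp_all

open scoped Classical in
/-- A cyclic invariant subspace of a pure row isometry is generated by a wandering vector. -/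
theorem exists_wandering [CompleteSpace K] {L : ι → K →L[ℂ] K} {vac : κ → K}
    (hL : ∀ i j x y, ⟪L i x, L j y⟫_ℂ = if i = j then ⟪x, y⟫_ℂ else 0)
    (hvac : ∀ k i x, ⟪vac k, L i x⟫_ℂ = 0)
    (hpure : ∀ x, (∀ w k, ⟪wordOp L w (vac k), x⟫_ℂ = 0) → x = 0)
    {F : K} {k₀ : κ} (hF : ⟪vac k₀, F⟫_ℂ ≠ 0) :
    ∃ Ω : K, Orthonormal ℂ (fun w => wordOp L w Ω) ∧ F ∈ cyclicSpan L Ω := by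
  have hNcl := isClosed_properSpan L F
  have hMcl := isClosed_cyclicSpan L F
  have hNM := properSpan_le_cyclicSpan L F
  have hFM : F ∈ cyclicSpan L F := by simpa using wordOp_mem_cyclicSpan L F []
  have : CompleteSpace (properSpan L F) := hNcl.completeSpace_coe
  have hNvac : ∀ k, ∀ y ∈ properSpan L F, ⟪vac k, y⟫_ℂ = 0 := fun k y hy => by
    have h : properSpan L F ≤ (innerSL ℂ (vac k)).ker :=
      properSpan_le ((innerSL ℂ (vac k)).isClosed_ker) fun i w => by
        simpa using hvac k i (wordOp L w F)
    simpa using h hy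
  obtain ⟨P, hP⟩ : ∃ P, P = (properSpan L F).starProjection F := ⟨_, rfl⟩
  have hPN : P ∈ properSpan L F := hP ▸ Submodule.starProjection_apply_mem _ _
  have hΩ₀N : ∀ y ∈ properSpan L F, ⟪F - P, y⟫_ℂ = 0 := fun y hy =>
    hP ▸ Submodule.starProjection_inner_eq_zero F y hy
  -- The vacuum is orthogonal to the proper span, since that lies in the closed span of the ranges
  -- of the `L i`, but it is not orthogonal to `F`.
  have hΩ₀ : F - P ≠ 0 := fun h0 => hF <| by
    rw [sub_eq_zero.1 h0]
    exact hNvac _ _ hPN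
  have hn : (‖F - P‖ : ℂ) ≠ 0 := by simpa using hΩ₀
  set Ω : K := (‖F - P‖ : ℂ)⁻¹ • (F - P) with hΩ
  have hΩM : Ω ∈ cyclicSpan L F :=
    Submodule.smul_mem _ _ (Submodule.sub_mem _ hFM (hNM hPN))
  have hΩN : ∀ y ∈ properSpan L F, ⟪Ω, y⟫_ℂ = 0 := fun y hy => by
    rw [hΩ, inner_smul_left, hΩ₀N y hy, mul_zero]
  have hΩ1 : ‖Ω‖ = 1 := by
    rw [hΩ, norm_smul]
    simp [hΩ₀]
  have hΩF : ⟪Ω, F⟫_ℂ • Ω = F - P := by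
    have e : F = (‖F - P‖ : ℂ) • Ω + P := by
      rw [hΩ, smul_smul, mul_inv_cancel₀ hn, one_smul, sub_add_cancel]
    have e' : ⟪Ω, F⟫_ℂ = ‖F - P‖ := by
      conv_lhs => rw [e]
      rw [inner_add_right, inner_smul_right, hΩN P hPN, inner_self_eq_norm_sq_to_K, hΩ1]
      simp
    rw [e', hΩ, smul_smul, mul_inv_cancel₀ hn, one_smul]
  refine ⟨Ω, orthonormal_wordOp hL hΩ1 fun i w => hΩN _ ?_, ?_⟩
  · simpa using map_mem_properSpan (wordOp_map_mem_cyclicSpan hΩM w) i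
  have hRcl := isClosed_cyclicSpan L Ω
  have hRM : cyclicSpan L Ω ≤ cyclicSpan L F :=
    cyclicSpan_le hMcl fun w => wordOp_map_mem_cyclicSpan hΩM w
  have : CompleteSpace (cyclicSpan L Ω) := hRcl.completeSpace_coe
  -- The cyclic span is the proper span plus the line of `Ω`: the projection `D` along `Ω` sends `F`
  -- to `P` and fixes all other words. It also fixes `y`.
  have hN_of : ∀ y ∈ cyclicSpan L F, (∀ w, ⟪wordOp L w Ω, y⟫_ℂ = 0) → y ∈ properSpan L F := by
    intro y hy hyΩ
    let D : K →L[ℂ] K := ContinuousLinearMap.id ℂ K - (innerSL ℂ Ω).smulRight Ω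
    have hD : ∀ x, D x = x - ⟪Ω, x⟫_ℂ • Ω := fun x => by simp [D]
    have h : cyclicSpan L F ≤ (properSpan L F).comap D.toLinearMap :=
      cyclicSpan_le (hNcl.preimage D.continuous) fun w => by
        change D (wordOp L w F) ∈ properSpan L F
        rw [hD]
        cases w with
        | nil => simpa [hΩF] using hPN
        | cons i w =>
          have := wordOp_mem_properSpan L F i w
          rwa [hΩN _ this, zero_smul, sub_zero]
    have h1 : D y ∈ properSpan L F := h hy
    have h2 : ⟪Ω, y⟫_ℂ = 0 := by simpa using hyΩ []
    rwa [hD, h2, zero_smul, sub_zero] at h1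
  have hadj : ∀ i, ∀ y ∈ properSpan L F,
      ContinuousLinearMap.adjoint (L i) y ∈ cyclicSpan L F := fun i y hy => by
    have hBL : ∀ j x, ContinuousLinearMap.adjoint (L i) (L j x) = if i = j then x else 0 := by
      intro j x
      refine ext_inner_left ℂ fun v => ?_
      rw [ContinuousLinearMap.adjoint_inner_right, hL]
      split_ifs <;> simp
    have h : properSpan L F ≤
        (cyclicSpan L F).comap (ContinuousLinearMap.adjoint (L i)).toLinearMap :=
      properSpan_le (hMcl.preimage (ContinuousLinearMap.adjoint (L i)).continuous) fun j w => by
        change ContinuousLinearMap.adjoint (L i) (wordOp L (j :: w) F) ∈ cyclicSpan L F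
        rw [wordOp_cons, hBL]
        split_ifs
        · exact wordOp_mem_cyclicSpan L F w
        · exact Submodule.zero_mem _
    exact h hy
  -- The part of the cyclic span of `F` orthogonal to all `L_v Ω` is stable under the adjoints of
  -- the `L i` and orthogonal to the vacuum vectors; purity then forces it to be zero.
  have hzero : ∀ w k, ∀ y ∈ cyclicSpan L F, (∀ v, ⟪wordOp L v Ω, y⟫_ℂ = 0) →
      ⟪wordOp L w (vac k), y⟫_ℂ = 0 := by
    intro w k
    induction w with
    | nil =>
      intro y hy hyΩ
      simpa using hNvac k y (hN_of y hy hyΩ)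
    | cons i w ih =>
      intro y hy hyΩ
      rw [wordOp_cons, ← ContinuousLinearMap.adjoint_inner_right]
      refine ih _ (hadj i y (hN_of y hy hyΩ)) fun v => ?_
      rw [ContinuousLinearMap.adjoint_inner_right]
      simpa using hyΩ (i :: v)
  have hfin : F - (cyclicSpan L Ω).starProjection F = 0 :=
    hpure _ fun w k => hzero w k _
      (Submodule.sub_mem _ hFM (hRM (Submodule.starProjection_apply_mem _ _))) fun v => by
        rw [← inner_conj_symm, Submodule.starProjection_inner_eq_zero F _
          (wordOp_mem_cyclicSpan L Ω v), map_zero]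
  rw [sub_eq_zero.1 hfin]
  exact Submodule.starProjection_apply_mem _ _

end RowIsometry

/-! ### Hilbert direct sums and diagonal operators. -/

theorem lp_hasSum_norm_sq {α E : Type*} [NormedAddCommGroup E] (f : lp (fun _ : α => E) 2) :
    HasSum (fun k => ‖f k‖ ^ 2) (‖f‖ ^ 2) := by
  have h := lp.hasSum_norm (p := 2) (by norm_num) f
  simpa using h

theorem memℓp_two_of_summable {α E : Type*} [NormedAddCommGroup E] {f : α → E}
    (h : Summable fun k => ‖f k‖ ^ 2) : Memℓp f 2 :=
  memℓp_gen (by simpa using h)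

section Lp

variable {α E F : Type*} [NormedAddCommGroup E] [InnerProductSpace ℂ E]
  [NormedAddCommGroup F] [InnerProductSpace ℂ F]

theorem lp_norm_map_le (T : E →L[ℂ] F) (f : lp (fun _ : α => E) 2) (k : α) :
    ‖T (f k)‖ ^ 2 ≤ ‖T‖ ^ 2 * ‖f k‖ ^ 2 := by
  rw [← mul_pow]
  exact pow_le_pow_left₀ (norm_nonneg _) (T.le_opNorm _) 2

/-- The diagonal operator with the entry `T`, as a linear map. -/
noncomputable def lpMapLinear (α : Type*) (T : E →L[ℂ] F) :
    lp (fun _ : α => E) 2 →ₗ[ℂ] lp (fun _ : α => F) 2 where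
  toFun f := ⟨fun k => T (f k), memℓp_two_of_summable <|
    Summable.of_nonneg_of_le (fun _ => sq_nonneg _) (lp_norm_map_le T f)
      ((lp_hasSum_norm_sq f).summable.mul_left _)⟩
  map_add' f g := lp.ext <| funext fun k => map_add T (f k) (g k)
  map_smul' c f := lp.ext <| funext fun k => map_smul T c (f k)

theorem norm_lpMapLinear_le (T : E →L[ℂ] F) (f : lp (fun _ : α => E) 2) :
    ‖lpMapLinear α T f‖ ≤ ‖T‖ * ‖f‖ := by
  refine (pow_le_pow_iff_left₀ (norm_nonneg _) (by positivity) two_ne_zero).1 ?_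
  rw [mul_pow]
  exact hasSum_le (lp_norm_map_le T f) (lp_hasSum_norm_sq (lpMapLinear α T f))
    ((lp_hasSum_norm_sq f).mul_left _)

/-- The diagonal operator with the entry `T` between direct sums of Hilbert spaces. -/
noncomputable def lpMap (α : Type*) (T : E →L[ℂ] F) : lp (fun _ : α => E) 2 →L[ℂ] lp (fun _ : α => F) 2 :=
  (lpMapLinear α T).mkContinuous ‖T‖ (norm_lpMapLinear_le T)

@[simp] theorem lpMap_apply (T : E →L[ℂ] F) (f : lp (fun _ : α => E) 2) (k : α) :
    lpMap α T f k = T (f k) := rfl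

theorem norm_lpMap_le (T : E →L[ℂ] F) : ‖lpMap α T‖ ≤ ‖T‖ :=
  LinearMap.mkContinuous_norm_le _ (norm_nonneg _) _

theorem lpMap_single [DecidableEq α] (T : E →L[ℂ] F) (k : α) (x : E) :
    lpMap α T (lp.single 2 k x) = lp.single 2 k (T x) := by
  ext j
  by_cases h : j = k
  · subst h; simp
  · simp [h]

/-- A closed subspace of `ℓ²` which contains the unit vectors is everything. -/
theorem mem_of_single_mem [DecidableEq α] {S : Submodule ℂ (lp (fun _ : α => ℂ) 2)}
    (hS : IsClosed (S : Set (lp (fun _ : α => ℂ) 2))) (h : ∀ k, lp.single 2 k 1 ∈ S)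
    (f : lp (fun _ : α => ℂ) 2) : f ∈ S := by
  refine hS.mem_of_tendsto (lp.hasSum_single (by norm_num) f)
    (Filter.Eventually.of_forall fun s => Submodule.sum_mem _ fun k _ => ?_)
  have e : lp.single 2 k (f k) = f k • (lp.single 2 k 1 : lp (fun _ : α => ℂ) 2) := by
    rw [← lp.single_smul, smul_eq_mul, mul_one]
  rw [e]
  exact S.smul_mem _ (h k)

theorem clm_eq_of_single [DecidableEq α] {S T : lp (fun _ : α => ℂ) 2 →L[ℂ] E}
    (h : ∀ k, S (lp.single 2 k 1) = T (lp.single 2 k 1)) (f : lp (fun _ : α => ℂ) 2) :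
    S f = T f := by
  have := mem_of_single_mem (S := (S - T).ker) (S - T).isClosed_ker
    (fun k => by simp [h k]) f
  simpa [sub_eq_zero] using this

variable [CompleteSpace E]

theorem linearIsometry_single [DecidableEq α] {v : α → E} (hv : Orthonormal ℂ v) (k : α) :
    hv.orthogonalFamily.linearIsometry (lp.single 2 k 1) = v k := by
  simp

/-- An isometry from a complete space has closed range. This supplies the quotient `G` in the
factorization of `F`. -/
theorem exists_linearIsometry_eq {v : α → E} (hv : Orthonormal ℂ v) {x : E}
    (hx : x ∈ (Submodule.span ℂ (Set.range v)).topologicalClosure) :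
    ∃ g, hv.orthogonalFamily.linearIsometry g = x := by
  classical
  have hcl : IsClosed (Set.range hv.orthogonalFamily.linearIsometry) :=
    hv.orthogonalFamily.linearIsometry.isometry.isClosedEmbedding.isClosed_range
  have h : (Submodule.span ℂ (Set.range v)).topologicalClosure ≤
      hv.orthogonalFamily.linearIsometry.toLinearMap.range := by
    refine Submodule.topologicalClosure_minimal _ (Submodule.span_le.2 ?_) ?_
    · rintro _ ⟨k, rfl⟩
      exact ⟨lp.single 2 k 1, linearIsometry_single hv k⟩
    · rw [LinearMap.coe_range]
      exact hcl
  exact h hx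

end Lp

/-! ### Geometric series over words. -/

section Words

variable {ι : Type*}

/-- Splitting off the first letter turns the bound `c = (1 - s)⁻¹` for tails into `1 + s c`, which
equals `c` again. -/
theorem sum_words_le {x : ι → ℝ} (hx : ∀ i, 0 ≤ x i) (hs : Summable x) (h1 : ∑' i, x i < 1)
    (n : ℕ) (F : Finset (List ι)) (hF : ∀ w ∈ F, w.length < n) :
    ∑ w ∈ F, (w.map x).prod ≤ (1 - ∑' i, x i)⁻¹ := by
  classical
  have hpos : 0 < 1 - ∑' i, x i := by linarith
  have hw : ∀ w : List ι, 0 ≤ (w.map x).prod := fun w =>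
    List.prod_nonneg (by simpa using fun i _ => hx i)
  induction n generalizing F with
  | zero =>
    rw [Finset.eq_empty_of_forall_notMem fun w hwF => absurd (hF w hwF) (Nat.not_lt_zero _)]
    simpa using hpos.le
  | succ n ih =>
    let A : Finset ι := F.biUnion List.toFinset
    -- The filter matters only for `n = 0`, where the tail of the empty word is too long.
    let G : Finset (List ι) := (F.image List.tail).filter fun w => w.length < n
    have hsub : F ⊆ insert [] ((A ×ˢ G).image fun p => p.1 :: p.2) := by
      intro w hwF
      cases w with
      | nil => simp
      | cons i w =>
        have hl : w.length < n := by simpa using hF _ hwF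
        refine Finset.mem_insert_of_mem (Finset.mem_image.2 ⟨(i, w), ?_, rfl⟩)
        refine Finset.mem_product.2 ⟨Finset.mem_biUnion.2 ⟨_, hwF, by simp⟩,
          Finset.mem_filter.2 ⟨Finset.mem_image.2 ⟨_, hwF, rfl⟩, hl⟩⟩
    have hG := ih G fun w hwG => (Finset.mem_filter.1 hwG).2
    have hA : ∑ i ∈ A, x i ≤ ∑' i, x i := hs.sum_le_tsum _ fun i _ => hx i
    calc ∑ w ∈ F, (w.map x).prod
        ≤ ∑ w ∈ insert [] ((A ×ˢ G).image fun p => p.1 :: p.2), (w.map x).prod :=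
          Finset.sum_le_sum_of_subset_of_nonneg hsub fun w _ _ => hw w
      _ = 1 + (∑ i ∈ A, x i) * ∑ w ∈ G, (w.map x).prod := by
          rw [Finset.sum_insert (by simp), Finset.sum_image (by
            rintro ⟨i, w⟩ _ ⟨j, v⟩ _ h
            simpa using h), Finset.sum_mul_sum, ← Finset.sum_product']
          simp
      _ ≤ 1 + (∑' i, x i) * (1 - ∑' i, x i)⁻¹ := by
          gcongr
          · exact Finset.sum_nonneg fun w _ => hw w
          · exact tsum_nonneg hx
      _ = (1 - ∑' i, x i)⁻¹ := by
          field_simp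
          ring

theorem summable_words {x : ι → ℝ} (hx : ∀ i, 0 ≤ x i) (hs : Summable x)
    (h1 : ∑' i, x i < 1) : Summable fun w : List ι => (w.map x).prod := by
  refine summable_of_sum_le (c := (1 - ∑' i, x i)⁻¹)
    (fun w => List.prod_nonneg (by simpa using fun i _ => hx i)) fun F => ?_
  exact sum_words_le hx hs h1 (F.sup List.length + 1) F fun w hw =>
    Nat.lt_succ_of_le (Finset.le_sup (f := List.length) hw)

/-- Words are either empty or a letter followed by a word. -/
def wordEquiv (ι : Type*) : Unit ⊕ (ι × List ι) ≃ List ι where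
  toFun := Sum.elim (fun _ => []) fun p => p.1 :: p.2
  invFun w := match w with
    | [] => Sum.inl ()
    | i :: w => Sum.inr (i, w)
  left_inv o := by cases o <;> rfl
  right_inv w := by cases w <;> rfl

/-- The geometric series over words. -/
theorem tsum_words {x : ι → ℂ} (hs : Summable fun i => ‖x i‖) (h1 : ∑' i, ‖x i‖ < 1) :
    ∑' w : List ι, (w.map x).prod = (1 - ∑' i, x i)⁻¹ := by
  have hw : Summable fun w : List ι => ‖(w.map x).prod‖ := by
    refine (summable_words (fun i => norm_nonneg (x i)) hs h1).congr fun w => ?_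
    induction w with
    | nil => simp
    | cons i w ih => simp [ih]
  have hso : Summable fun o : Unit ⊕ (ι × List ι) => ((wordEquiv ι o).map x).prod :=
    (wordEquiv ι).summable_iff (f := fun w : List ι => (w.map x).prod).2 hw.of_norm
  have e : ∑' w : List ι, (w.map x).prod =
      1 + (∑' i, x i) * ∑' w : List ι, (w.map x).prod := by
    calc ∑' w : List ι, (w.map x).prod
        = ∑' o : Unit ⊕ (ι × List ι), ((wordEquiv ι o).map x).prod :=
          ((wordEquiv ι).tsum_eq fun w : List ι => (w.map x).prod).symm
      _ = 1 + ∑' p : ι × List ι, x p.1 * (p.2.map x).prod := by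
          rw [Summable.tsum_sum (hso.comp_injective Sum.inl_injective)
            (hso.comp_injective Sum.inr_injective)]
          simp [wordEquiv]
      _ = _ := by rw [tsum_mul_tsum_of_summable_norm hs hw]
  have hne : 1 - ∑' i, x i ≠ 0 := fun h0 => by
    have : ‖∑' i, x i‖ < 1 := (norm_tsum_le_tsum_norm hs).trans_lt h1
    rw [← sub_eq_zero.1 h0] at this
    simp at this
  rw [← mul_eq_one_iff_eq_inv₀ hne]
  linear_combination e

end Words

/-! ### The full Fock space and its creation operators. -/

section Fock

variable {ι : Type*}

/-- The full Fock space: square-summable families indexed by the words in the alphabet `ι`. -/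
abbrev Fock (ι : Type*) : Type _ := lp (fun _ : List ι => ℂ) 2

/-- The vector `(conj z^w)_w` of the full Fock space, which evaluates at `z`. -/
noncomputable def fockKernel (z : UnitBall ι) : Fock ι :=
  ⟨fun w => conj ((w.map z.1).prod), memℓp_two_of_summable <| by
    have h := lp_hasSum_norm_sq z.1
    have hz : ‖z.1‖ < 1 := mem_ball_zero_iff.1 z.2
    refine (summable_words (fun i => sq_nonneg ‖z.1 i‖) h.summable ?_).congr fun w => ?_
    · rw [h.tsum_eq]
      exact pow_lt_one₀ (norm_nonneg _) hz two_ne_zero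
    · rw [RCLike.norm_conj]
      induction w with
      | nil => simp
      | cons i w ih => simp only [List.map_cons, List.prod_cons, norm_mul, mul_pow, ih]⟩

theorem fockKernel_apply (z : UnitBall ι) (w : List ι) :
    fockKernel z w = conj ((w.map z.1).prod) := rfl

theorem inner_fockKernel (z u : UnitBall ι) : ⟪fockKernel z, fockKernel u⟫_ℂ = kernel z u := by
  have hz : ‖z.1‖ < 1 := mem_ball_zero_iff.1 z.2
  have hu : ‖u.1‖ < 1 := mem_ball_zero_iff.1 u.2
  have hpq : (2 : ENNReal).toReal.HolderConjugate (2 : ENNReal).toReal := by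
    rw [Real.holderConjugate_iff]; norm_num
  have e : ∀ i, ‖z.1 i * conj (u.1 i)‖ = ‖z.1 i‖ * ‖u.1 i‖ := fun i => by simp
  -- The side goals of `tsum_words` are absolute summability and a sum below one, both by
  -- Cauchy–Schwarz for points of the ball.
  rw [kernel_eq_tsum, ← tsum_words, lp.inner_eq_tsum]
  · refine tsum_congr fun w => ?_
    simp only [fockKernel_apply]
    induction w with
    | nil => simp
    | cons i w ih =>
      simp only [List.map_cons, List.prod_cons, map_mul, RCLike.inner_apply,
        RCLike.conj_conj] at ih ⊢
      rw [← ih]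
      ring
  · exact (lp.summable_mul hpq z.1 u.1).congr fun i => (e i).symm
  · simp only [e]
    exact (lp.tsum_mul_le_mul_norm' hpq z.1 u.1).trans_lt
      (mul_lt_one_of_nonneg_of_lt_one_left (norm_nonneg _) hz hu.le)

variable [DecidableEq ι]

theorem orthonormal_single {α : Type*} [DecidableEq α] :
    Orthonormal ℂ fun k : α => (lp.single 2 k 1 : lp (fun _ : α => ℂ) 2) := by
  rw [orthonormal_iff_ite]
  intro i j
  rw [lp.inner_single_left]
  by_cases h : i = j
  · subst h; simp
  · simp [h]

theorem orthonormal_single_cons (i : ι) :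
    Orthonormal ℂ fun w : List ι => (lp.single 2 (i :: w) 1 : Fock ι) :=
  orthonormal_single.comp (fun w => i :: w) (List.cons_injective)

/-- The left creation operator with the letter `i`. -/
noncomputable def creation (i : ι) : Fock ι →L[ℂ] Fock ι :=
  (orthonormal_single_cons i).orthogonalFamily.linearIsometry.toContinuousLinearMap

theorem creation_single (i : ι) (w : List ι) :
    creation i (lp.single 2 w 1) = lp.single 2 (i :: w) 1 :=
  linearIsometry_single (orthonormal_single_cons i) w

theorem inner_creation (i j : ι) (x y : Fock ι) :
    ⟪creation i x, creation j y⟫_ℂ = if i = j then ⟪x, y⟫_ℂ else 0 := by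
  split_ifs with h
  · subst h
    exact LinearIsometry.inner_map_map _ x y
  · rw [← ContinuousLinearMap.adjoint_inner_right, ← ContinuousLinearMap.comp_apply]
    have : ∀ f, (ContinuousLinearMap.adjoint (creation i) ∘L creation j) f =
        (0 : Fock ι →L[ℂ] Fock ι) f := clm_eq_of_single fun w => by
      rw [ContinuousLinearMap.comp_apply, creation_single, zero_apply]
      refine ext_inner_left ℂ fun v => ?_
      rw [ContinuousLinearMap.adjoint_inner_right, inner_zero_right, ← inner_conj_symm,
        ← innerSL_apply_apply ℂ, ← ContinuousLinearMap.comp_apply]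
      have h0 : ∀ v, (innerSL ℂ (lp.single 2 (j :: w) 1 : Fock ι) ∘L creation i) v =
          (0 : Fock ι →L[ℂ] ℂ) v := clm_eq_of_single fun u => by
        rw [ContinuousLinearMap.comp_apply, creation_single, innerSL_apply_apply,
          lp.inner_single_left]
        simp [Ne.symm h]
      rw [h0 v]
      simp
    rw [this y]
    simp

theorem creation_apply_nil (i : ι) (x : Fock ι) : creation i x [] = 0 := by
  have h : ∀ x, (innerSL ℂ (lp.single 2 [] 1 : Fock ι) ∘L creation i) x =
      (0 : Fock ι →L[ℂ] ℂ) x := clm_eq_of_single fun u => by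
    rw [ContinuousLinearMap.comp_apply, creation_single, innerSL_apply_apply,
      lp.inner_single_left]
    simp
  have := h x
  rw [ContinuousLinearMap.comp_apply, innerSL_apply_apply, lp.inner_single_left] at this
  simpa using this

theorem fockKernel_inner_single (z : UnitBall ι) (w : List ι) :
    ⟪fockKernel z, (lp.single 2 w 1 : Fock ι)⟫_ℂ = (w.map z.1).prod := by
  rw [lp.inner_single_right, fockKernel_apply]
  simp

theorem fockKernel_inner_creation (z : UnitBall ι) (i : ι) (x : Fock ι) :
    ⟪fockKernel z, creation i x⟫_ℂ = z.1 i * ⟪fockKernel z, x⟫_ℂ := by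
  have h : ∀ x, (innerSL ℂ (fockKernel z) ∘L creation i) x =
      (z.1 i • innerSL ℂ (fockKernel z)) x := clm_eq_of_single fun u => by
    rw [ContinuousLinearMap.comp_apply, creation_single, smul_apply,
      innerSL_apply_apply, innerSL_apply_apply, fockKernel_inner_single, fockKernel_inner_single]
    simp
  simpa using h x

theorem fockKernel_inner_wordOp (z : UnitBall ι) (w : List ι) (x : Fock ι) :
    ⟪fockKernel z, wordOp creation w x⟫_ℂ = (w.map z.1).prod * ⟪fockKernel z, x⟫_ℂ := by
  induction w with
  | nil => simp
  | cons i w ih => simp [fockKernel_inner_creation, ih, mul_assoc]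

end Fock

/-! ### The Drury–Arveson space inside the Fock space. -/

section Lift

theorem inner_linearCombination {X E : Type*} [NormedAddCommGroup E] [InnerProductSpace ℂ E]
    (v : X → E) (c : X →₀ ℂ) :
    ⟪Finsupp.linearCombination ℂ v c, Finsupp.linearCombination ℂ v c⟫_ℂ =
      ∑ x ∈ c.support, ∑ y ∈ c.support, conj (c x) * (c y * ⟪v x, v y⟫_ℂ) := by
  rw [Finsupp.linearCombination_apply, Finsupp.sum, sum_inner]
  refine Finset.sum_congr rfl fun x _ => ?_
  rw [inner_sum]
  refine Finset.sum_congr rfl fun y _ => ?_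
  rw [inner_smul_left, inner_smul_right]

theorem norm_linearCombination_eq {X E F : Type*} [NormedAddCommGroup E] [InnerProductSpace ℂ E]
    [NormedAddCommGroup F] [InnerProductSpace ℂ F] {v : X → E} {u : X → F}
    (h : ∀ x y, ⟪v x, v y⟫_ℂ = ⟪u x, u y⟫_ℂ) (c : X →₀ ℂ) :
    ‖Finsupp.linearCombination ℂ v c‖ = ‖Finsupp.linearCombination ℂ u c‖ := by
  have e : ⟪Finsupp.linearCombination ℂ v c, Finsupp.linearCombination ℂ v c⟫_ℂ =
      ⟪Finsupp.linearCombination ℂ u c, Finsupp.linearCombination ℂ u c⟫_ℂ := by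
    simp only [inner_linearCombination, h]
  rw [inner_self_eq_norm_sq_to_K, inner_self_eq_norm_sq_to_K] at e
  exact (pow_left_inj₀ (norm_nonneg _) (norm_nonneg _) two_ne_zero).1 (by exact_mod_cast e)

variable {ι : Type*}

/-- The kernel function `k(·, z)` as an element of `H²_d`. -/
noncomputable def kernelVec (z : UnitBall ι) : H2 ι := RKHS.kerFun (H2 ι) z 1

theorem inner_kernelVec (z : UnitBall ι) (f : H2 ι) : ⟪kernelVec z, f⟫_ℂ = f z := by
  rw [kernelVec, RKHS.kerFun_inner]
  simp

theorem kernelVec_apply (z u : UnitBall ι) : kernelVec u z = kernel z u := by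
  rw [kernelVec, RKHS.kerFun_apply, kernel_H2]
  simp [kernelMatrix]

theorem denseRange_kernelVec :
    DenseRange (Finsupp.linearCombination ℂ (kernelVec : UnitBall ι → H2 ι)) := by
  have h := RKHS.kerFun_dense (H2 ι)
  have hle : Submodule.span ℂ {RKHS.kerFun (H2 ι) x v | (x) (v)} ≤
      LinearMap.range (Finsupp.linearCombination ℂ (kernelVec : UnitBall ι → H2 ι)) := by
    rw [Finsupp.range_linearCombination, Submodule.span_le]
    rintro _ ⟨x, v, rfl⟩
    have : RKHS.kerFun (H2 ι) x v = v • kernelVec x := by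
      rw [kernelVec, ← map_smul, smul_eq_mul, mul_one]
    rw [this]
    exact Submodule.smul_mem _ _ (Submodule.subset_span ⟨x, rfl⟩)
  have hd : Dense (LinearMap.range
      (Finsupp.linearCombination ℂ (kernelVec : UnitBall ι → H2 ι)) : Set (H2 ι)) :=
    (Submodule.dense_iff_topologicalClosure_eq_top.2 h).mono hle
  rwa [LinearMap.coe_range] at hd

/-- Both families have the Gram matrix `k(z, u)`. This makes `fockLift` well defined and
contractive. -/
theorem norm_linearCombination_fockKernel (c : UnitBall ι →₀ ℂ) :
    ‖Finsupp.linearCombination ℂ (fockKernel : UnitBall ι → Fock ι) c‖ =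
      ‖Finsupp.linearCombination ℂ (kernelVec : UnitBall ι → H2 ι) c‖ :=
  norm_linearCombination_eq (fun z u => by
    rw [inner_fockKernel, inner_kernelVec, kernelVec_apply]) c

/-- The isometric embedding of `H²_d` into the full Fock space. -/
noncomputable def fockLift (ι : Type*) : H2 ι →L[ℂ] Fock ι :=
  (Finsupp.linearCombination ℂ (fockKernel : UnitBall ι → Fock ι)).extendOfNorm
    (Finsupp.linearCombination ℂ (kernelVec : UnitBall ι → H2 ι))

theorem fockLift_kernelVec (z : UnitBall ι) : fockLift ι (kernelVec z) = fockKernel z := by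
  have h := LinearMap.extendOfNorm_eq
    (f := Finsupp.linearCombination ℂ (fockKernel : UnitBall ι → Fock ι))
    denseRange_kernelVec
    ⟨1, fun c => by rw [one_mul, norm_linearCombination_fockKernel]⟩ (Finsupp.single z 1)
  rwa [Finsupp.linearCombination_single, Finsupp.linearCombination_single, one_smul,
    one_smul] at h

theorem norm_fockLift_le (f : H2 ι) : ‖fockLift ι f‖ ≤ ‖f‖ := by
  have h := LinearMap.norm_extendOfNorm_apply_le
    (f := Finsupp.linearCombination ℂ (fockKernel : UnitBall ι → Fock ι))
    denseRange_kernelVec 1 (fun c => by rw [one_mul, norm_linearCombination_fockKernel]) f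
  rwa [one_mul] at h

theorem norm_fockLift_le_one : ‖fockLift ι‖ ≤ 1 :=
  ContinuousLinearMap.opNorm_le_bound _ zero_le_one fun f => by
    rw [one_mul]; exact norm_fockLift_le f

/-- The restriction of an element of the full Fock space to the commutative ball. -/
noncomputable def fockRestrict (ι : Type*) : Fock ι →L[ℂ] H2 ι :=
  ContinuousLinearMap.adjoint (fockLift ι)

theorem norm_fockRestrict_le_one : ‖fockRestrict ι‖ ≤ 1 := by
  rw [fockRestrict, LinearIsometryEquiv.norm_map]
  exact norm_fockLift_le_one

theorem fockRestrict_apply (F : Fock ι) (z : UnitBall ι) :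
    fockRestrict ι F z = ⟪fockKernel z, F⟫_ℂ := by
  rw [← inner_kernelVec, fockRestrict, ContinuousLinearMap.adjoint_inner_right,
    fockLift_kernelVec]

theorem inner_fockLift (f : H2 ι) (z : UnitBall ι) : ⟪fockKernel z, fockLift ι f⟫_ℂ = f z := by
  rw [← inner_kernelVec]
  refine denseRange_kernelVec.induction_on (p := fun f => ⟪fockKernel z, fockLift ι f⟫_ℂ =
    ⟪kernelVec z, f⟫_ℂ) f (isClosed_eq (by fun_prop) (by fun_prop)) fun c => ?_
  rw [Finsupp.linearCombination_apply, Finsupp.sum, map_sum, inner_sum, inner_sum]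
  refine Finset.sum_congr rfl fun u _ => ?_
  rw [map_smul, inner_smul_right, inner_smul_right, fockLift_kernelVec, inner_fockKernel,
    inner_kernelVec, kernelVec_apply]

theorem fockRestrict_fockLift (f : H2 ι) : fockRestrict ι (fockLift ι f) = f :=
  RKHS.ext fun z => by rw [fockRestrict_apply, inner_fockLift]

end Lift

/-! ### Multipliers obtained from wandering vectors. -/

section Factorization

variable {ι κ : Type*}

theorem IsContractiveColumn.isMultiplier {φ : κ → UnitBall ι → ℂ} (h : IsContractiveColumn φ)
    (k : κ) : IsMultiplier (φ k) := by
  obtain ⟨T, -, hT⟩ := h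
  exact ⟨lp.evalCLM ℂ (fun _ : κ => H2 ι) 2 k ∘L T, fun f z => hT f k z⟩

/-- A multiplier whose reciprocal belongs to `H²_d` is outer. -/
theorem IsMultiplier.isOuter {a : UnitBall ι → ℂ} (ha : IsMultiplier a) {g : H2 ι}
    (hg : ∀ z, a z * g z = 1) : IsOuter a := by
  classical
  refine ⟨ha, ?_⟩
  obtain ⟨T, hT⟩ := ha
  let S : Submodule ℂ (H2 ι) := T.range.topologicalClosure
  have hS : IsClosed (S : Set (H2 ι)) := Submodule.isClosed_topologicalClosure _
  -- Each monomial is `z^w = a · (z^w g)`, and `z^w g` is in the space as the restriction of `L_w`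
  -- applied to the lift of `g`.
  have hmem : ∀ F : Fock ι, fockRestrict ι F ∈ S := fun F => by
    refine mem_of_single_mem (S := S.comap (fockRestrict ι).toLinearMap)
      (hS.preimage (fockRestrict ι).continuous) (fun w => ?_) F
    refine Submodule.le_topologicalClosure _
      ⟨fockRestrict ι (wordOp creation w (fockLift ι g)), RKHS.ext fun z => ?_⟩
    change T _ z = fockRestrict ι (lp.single 2 w 1) z
    rw [hT, fockRestrict_apply, fockRestrict_apply, fockKernel_inner_wordOp, inner_fockLift,
      fockKernel_inner_single]
    linear_combination (w.map z.1).prod * hg z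
  have htop : S = ⊤ := Submodule.eq_top_iff'.2 fun f => by
    simpa only [fockRestrict_fockLift] using hmem (fockLift ι f)
  refine (Submodule.dense_iff_topologicalClosure_eq_top.2 htop).mono ?_
  rintro _ ⟨f, rfl⟩
  exact ⟨f, fun z => hT f z⟩

variable [DecidableEq ι]

theorem wordOp_lpMap_apply (w : List ι) (x : lp (fun _ : κ => Fock ι) 2) (k : κ) :
    wordOp (fun i => lpMap κ (creation i)) w x k = wordOp creation w (x k) := by
  induction w with
  | nil => simp
  | cons i w ih => simp [ih]

/-- On the unit vector at `w` both sides are `z^w Ω_k(z)`, as each creation operator evaluates to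
multiplication by a coordinate. -/
theorem fockKernel_inner_linearIsometry {Ω : lp (fun _ : κ => Fock ι) 2}
    (hΩ : Orthonormal ℂ fun w => wordOp (fun i => lpMap κ (creation i)) w Ω) (z : UnitBall ι)
    (k : κ) (f : Fock ι) :
    ⟪fockKernel z, hΩ.orthogonalFamily.linearIsometry f k⟫_ℂ =
      ⟪fockKernel z, Ω k⟫_ℂ * ⟪fockKernel z, f⟫_ℂ := by
  refine clm_eq_of_single
    (S := innerSL ℂ (fockKernel z) ∘L lp.evalCLM ℂ (fun _ : κ => Fock ι) 2 k ∘L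
      hΩ.orthogonalFamily.linearIsometry.toContinuousLinearMap)
    (T := ⟪fockKernel z, Ω k⟫_ℂ • innerSL ℂ (fockKernel z)) (fun w => ?_) f
  change ⟪fockKernel z, hΩ.orthogonalFamily.linearIsometry (lp.single 2 w 1) k⟫_ℂ =
      ⟪fockKernel z, Ω k⟫_ℂ * ⟪fockKernel z, (lp.single 2 w 1 : Fock ι)⟫_ℂ
  rw [linearIsometry_single hΩ, wordOp_lpMap_apply, fockKernel_inner_wordOp,
    fockKernel_inner_single, mul_comm]

/-- The column given by a wandering vector of the creation operators is contractive. -/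
theorem isContractiveColumn_of_orthonormal {Ω : lp (fun _ : κ => Fock ι) 2}
    (hΩ : Orthonormal ℂ fun w => wordOp (fun i => lpMap κ (creation i)) w Ω) :
    IsContractiveColumn fun (k : κ) (z : UnitBall ι) => ⟪fockKernel z, Ω k⟫_ℂ := by
  refine ⟨lpMap κ (fockRestrict ι) ∘L
    hΩ.orthogonalFamily.linearIsometry.toContinuousLinearMap ∘L fockLift ι,
    ContinuousLinearMap.opNorm_le_bound _ zero_le_one fun f => ?_, fun f k z => ?_⟩
  · calc _ ≤ ‖lpMap κ (fockRestrict ι)‖ * ‖hΩ.orthogonalFamily.linearIsometry (fockLift ι f)‖ :=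
          ContinuousLinearMap.le_opNorm _ _
      _ ≤ 1 * ‖f‖ := by
          rw [LinearIsometry.norm_map]
          gcongr
          · exact (norm_lpMap_le _).trans norm_fockRestrict_le_one
          · exact norm_fockLift_le f
  · change fockRestrict ι (hΩ.orthogonalFamily.linearIsometry (fockLift ι f) k) z = _
    rw [fockRestrict_apply, fockKernel_inner_linearIsometry hΩ, inner_fockLift]

/-- Every vector which does not vanish at the empty word is generated by a wandering vector. -/
theorem exists_wandering_creation {F : lp (fun _ : κ => Fock ι) 2} {k₀ : κ} (hF : F k₀ [] ≠ 0) :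
    ∃ Ω : lp (fun _ : κ => Fock ι) 2,
      Orthonormal ℂ (fun w => wordOp (fun i => lpMap κ (creation i)) w Ω) ∧
      F ∈ cyclicSpan (fun i => lpMap κ (creation i)) Ω := by
  classical
  have hsingle : ∀ w (k : κ), wordOp (fun i => lpMap κ (creation i)) w
      (lp.single 2 k (lp.single 2 [] 1 : Fock ι)) = lp.single 2 k (lp.single 2 w 1) := by
    intro w k
    induction w with
    | nil => simp
    | cons i w ih => rw [wordOp_cons, ih, lpMap_single, creation_single]
  have hinner : ∀ (k : κ) w (x : lp (fun _ : κ => Fock ι) 2),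
      ⟪lp.single 2 k (lp.single 2 w 1 : Fock ι), x⟫_ℂ = x k w := fun k w x => by
    rw [lp.inner_single_left, lp.inner_single_left]
    simp
  refine exists_wandering (vac := fun k : κ => lp.single 2 k (lp.single 2 [] 1 : Fock ι))
    (k₀ := k₀) (fun i j x y => ?_) (fun k i x => ?_) (fun x hx => ?_) ?_
  · rw [lp.inner_eq_tsum, lp.inner_eq_tsum]
    simp only [lpMap_apply, inner_creation]
    split_ifs
    · rfl
    · exact tsum_zero
  · rw [hinner, lpMap_apply, creation_apply_nil]
  · refine lp.ext (funext fun k => lp.ext (funext fun w => ?_))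
    rw [← hinner, ← hsingle]
    exact hx w k
  · rwa [hinner]

end Factorization

/-! ### The augmented column and the conclusion. -/

/-- The column `(1, h₁, h₂, …)` lifted to the full Fock space. -/
noncomputable def augmentedColumn {ι : Type*} (h : ℕ → H2 ι) (k : Option ℕ) : Fock ι :=
  fockLift ι (k.elim (kernelVec ⟨0, Metric.mem_ball_self one_pos⟩) h)

theorem hasSum_option_of_hasSum {f : Option ℕ → ℝ} {s : ℝ} (h : HasSum (fun n => f (some n)) s) :
    HasSum f (f none + s) := by
  rw [← (Equiv.optionEquivSumPUnit.{0} ℕ).symm.hasSum_iff, add_comm]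
  exact HasSum.sum h (hasSum_unique _)

theorem kernelVec_zero_apply {ι : Type*} (z : UnitBall ι) :
    kernelVec ⟨0, Metric.mem_ball_self one_pos⟩ z = 1 := by
  rw [kernelVec_apply]
  simp [kernel]

/-- Its squared norm is `k(0, 0) = 1`; this is the `1` in the final bound. -/
theorem norm_kernelVec_zero {ι : Type*} :
    ‖(kernelVec ⟨0, Metric.mem_ball_self one_pos⟩ : H2 ι)‖ = 1 := by
  have h := inner_self_eq_norm_sq_to_K (𝕜 := ℂ)
    (kernelVec ⟨0, Metric.mem_ball_self one_pos⟩ : H2 ι)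
  rw [inner_kernelVec, kernelVec_zero_apply] at h
  have h' : ‖(kernelVec ⟨0, Metric.mem_ball_self one_pos⟩ : H2 ι)‖ ^ 2 = 1 := by
    exact Complex.ofReal_injective (by rw [Complex.ofReal_pow, Complex.ofReal_one]; exact h.symm)
  exact (pow_eq_one_iff_of_nonneg (norm_nonneg _) two_ne_zero).1 h'

theorem exists_lp_augmentedColumn {ι : Type*} {h : ℕ → H2 ι} (hh : Summable fun i => ‖h i‖ ^ 2) :
    ∃ F : lp (fun _ : Option ℕ => Fock ι) 2, (∀ k, F k = augmentedColumn h k) ∧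
      ‖F‖ ^ 2 ≤ 1 + ∑' i, ‖h i‖ ^ 2 := by
  have hs : HasSum (fun k : Option ℕ =>
      ‖(k.elim (kernelVec ⟨0, Metric.mem_ball_self one_pos⟩) h : H2 ι)‖ ^ 2)
      (1 + ∑' i, ‖h i‖ ^ 2) := by
    convert! hasSum_option_of_hasSum (f := fun k : Option ℕ =>
      ‖(k.elim (kernelVec ⟨0, Metric.mem_ball_self one_pos⟩) h : H2 ι)‖ ^ 2) hh.hasSum
    simp [norm_kernelVec_zero]
  have hle : ∀ k, ‖augmentedColumn h k‖ ^ 2 ≤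
      ‖(k.elim (kernelVec ⟨0, Metric.mem_ball_self one_pos⟩) h : H2 ι)‖ ^ 2 := fun k =>
    pow_le_pow_left₀ (norm_nonneg _) (norm_fockLift_le _) 2
  let F : lp (fun _ : Option ℕ => Fock ι) 2 := ⟨augmentedColumn h, memℓp_two_of_summable
    (Summable.of_nonneg_of_le (fun _ => sq_nonneg _) hle hs.summable)⟩
  exact ⟨F, fun _ => rfl, hasSum_le hle (lp_hasSum_norm_sq F) hs⟩

end DruryArveson

open DruryArveson in
theorem mainTheorem4 {ι : Type*} [Countable ι] (h : ℕ → DruryArveson.H2 ι)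
    (hh : Summable fun i => ‖h i‖ ^ 2) :
    ∃ (a : DruryArveson.UnitBall ι → ℂ) (b : ℕ → DruryArveson.UnitBall ι → ℂ),
      DruryArveson.IsMultiplier a ∧ (∀ i, DruryArveson.IsMultiplier (b i)) ∧
      DruryArveson.IsOuter a ∧
      (∀ z, a z ≠ 0) ∧ (∀ i z, h i z = b i z / a z) ∧
      DruryArveson.IsContractiveColumn (fun k : Option ℕ => k.elim a b) ∧
      ∃ g : DruryArveson.H2 ι, (∀ z, g z = 1 / a z) ∧ ‖g‖ ^ 2 ≤ 1 + ∑' i, ‖h i‖ ^ 2 := by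
  classical
  obtain ⟨F, hF, hFn⟩ := exists_lp_augmentedColumn hh
  -- The entry `none` lifts the constant function `1`, whose coefficient at the empty word is `1`.
  have hF0 : F none [] ≠ 0 := by
    rw [hF, augmentedColumn, Option.elim_none, fockLift_kernelVec, fockKernel_apply, List.map_nil,
      List.prod_nil, map_one]
    exact one_ne_zero
  obtain ⟨Ω, hΩ, hFΩ⟩ := exists_wandering_creation hF0
  obtain ⟨G, hG⟩ := exists_linearIsometry_eq hΩ hFΩ
  have hcol := isContractiveColumn_of_orthonormal hΩ
  have hval : ∀ k z, ⟪fockKernel z, Ω k⟫_ℂ * fockRestrict ι G z =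
      (k.elim (kernelVec ⟨0, Metric.mem_ball_self one_pos⟩) h : H2 ι) z := fun k z => by
    rw [fockRestrict_apply, ← fockKernel_inner_linearIsometry hΩ, hG, hF, augmentedColumn,
      inner_fockLift]
  -- This one identity gives the absence of zeros, the formula for `1/a` and outerness.
  have h1 : ∀ z, ⟪fockKernel z, Ω none⟫_ℂ * fockRestrict ι G z = 1 := fun z =>
    (hval none z).trans (kernelVec_zero_apply z)
  have hne : ∀ z, ⟪fockKernel z, Ω none⟫_ℂ ≠ 0 := fun z => left_ne_zero_of_mul_eq_one (h1 z)
  refine ⟨fun z => ⟪fockKernel z, Ω none⟫_ℂ, fun i z => ⟪fockKernel z, Ω (some i)⟫_ℂ,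
    hcol.isMultiplier none, fun i => hcol.isMultiplier (some i),
    (hcol.isMultiplier none).isOuter h1, hne, fun i z => ?_, ?_, fockRestrict ι G,
    fun z => ?_, le_trans ?_ hFn⟩
  · rw [eq_div_iff (hne z)]
    have hi : ⟪fockKernel z, Ω (some i)⟫_ℂ * fockRestrict ι G z = h i z := hval (some i) z
    rw [← hi]
    linear_combination ⟪fockKernel z, Ω (some i)⟫_ℂ * h1 z
  · convert! hcol using 2 with k
    cases k <;> rfl
  · rw [eq_div_iff (hne z), mul_comm, h1 z]
  · refine pow_le_pow_left₀ (norm_nonneg _) ?_ 2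
    calc ‖fockRestrict ι G‖ ≤ ‖fockRestrict ι‖ * ‖G‖ := ContinuousLinearMap.le_opNorm _ _
      _ ≤ 1 * ‖G‖ := by gcongr; exact norm_fockRestrict_le_one
      _ = ‖F‖ := by rw [one_mul, ← hG, LinearIsometry.norm_map]
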